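/- Let $G$ be a finite simple graph of tree-width at most $2$. Then $\vec{\chi}(G)\le 10$. Here the proper chromatic number $\vec{\chi}(G)$ is the minimum, over all orientations of the edges of $G$ in which any two adjacent vertices have different outdegrees, of the largest outdegree $\max\{d^+(v) : v\in V(G)\}$ (read as $0$ if $G$ has no vertices). -/

import Mathlib

namespace SimpleGraph

variable {V : Type*}

/-- `D` is an orientation of the simple graph `G`: all arcs of `D` run along edges of `G`, and
for every edge `uv` of `G` exactly one of the arcs `u → v` and `v → u` is present. -/
structure IsOrientation (G : SimpleGraph V) (D : Digraph V) : Prop where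
  adj_of_arc : ∀ u v, D.Adj u v → G.Adj u v
  exactly_one : ∀ u v, G.Adj u v → Xor (D.Adj u v) (D.Adj v u)

/-- The outdegree of the vertex `v` in the digraph `D`. -/
noncomputable def outdegree (D : Digraph V) (v : V) : ℕ∞ :=
  {w : V | D.Adj v w}.encard

/-- A proper orientation: adjacent vertices have different outdegrees. -/
structure IsProperOrientation (G : SimpleGraph V) (D : Digraph V) : Prop
    extends G.IsOrientation D where
  outdegree_ne : ∀ u v, G.Adj u v → outdegree D u ≠ outdegree D v

/-- The proper chromatic number: the minimum over all proper orientations of the largest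
outdegree (`⊤` if there were no proper orientation). -/
noncomputable def properChromaticNumber (G : SimpleGraph V) : ℕ∞ :=
  ⨅ (D : Digraph V) (_ : G.IsProperOrientation D), ⨆ v : V, outdegree D v

/-- A tree-decomposition of `G` whose tree has node set `ι`. -/
structure TreeDecomposition (G : SimpleGraph V) (ι : Type*) where
  /-- The tree of the decomposition. -/
  tree : SimpleGraph ι
  isTree : tree.IsTree
  /-- The bag of each node. -/
  bag : ι → Set V
  /-- Every vertex lies in some bag. -/
  vertex_mem : ∀ v : V, ∃ t, v ∈ bag t
  /-- Both ends of every edge lie in a common bag. -/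
  edge_mem : ∀ u v : V, G.Adj u v → ∃ t, u ∈ bag t ∧ v ∈ bag t
  /-- The nodes whose bags contain a given vertex induce a connected subgraph of the tree. -/
  connected : ∀ v : V, (tree.induce {t | v ∈ bag t}).Preconnected

/-- The width: the largest size of a bag, minus one (truncated to `0` if all bags are empty). -/
noncomputable def TreeDecomposition.width {G : SimpleGraph V} {ι : Type*}
    (T : G.TreeDecomposition ι) : ℕ∞ :=
  (⨆ t : ι, (T.bag t).encard) - 1

/-- The tree-width: the minimum width of a tree-decomposition of `G` over a finite tree. The node
set of a finite tree may be taken to be `Fin n`. -/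
noncomputable def treewidth (G : SimpleGraph V) : ℕ∞ :=
  ⨅ (n : ℕ) (T : G.TreeDecomposition (Fin n)), T.width

end SimpleGraph

namespace SimpleGraph

open Finset

/-! ### Pinning an independent set at a prescribed outdegree. -/

section Pinning

variable {V : Type*}

/-! Tree-width at most 2 gives 2-degeneracy, hence a proper 3-colouring and sets `Z v` of at most
two vertices such that every edge `uv` has `v ∈ Z u` or `u ∈ Z v`.

The orientation is built in rounds with falling values `q`. Each round fixes an independent set `F`
of vertices at outdegree exactly `q`; all remaining vertices are to end below `q`, so they never tie
with `F`. A pinned `u` always points to its remaining neighbours in `Z u`. Hence a surviving vertex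
points only to pinned members of its own `Z`, at most two in all (`Sparse`), and pinned vertices
have nearly free choice of their out-neighbours. Each arc from `F` to a survivor lowers the
survivor's potential by one.

Rounds at 10, 9, 8 treat one colour class each (`exists_round_single`), rounds at 7 and 6 two
classes (`exists_round_double`), and the round at 5 all three (`exists_round_triple`). Then every
potential is at most 4, and repeatedly making a vertex of largest potential a source finishes
(`solvable_potential`). -/

/-- The neighbours of `v` in the finite set `U`. -/
noncomputable def nbrs (G : SimpleGraph V) (U : Finset V) (v : V) : Finset V :=
  open Classical in {w ∈ U | G.Adj v w}

@[simp]
theorem mem_nbrs {G : SimpleGraph V} {U : Finset V} {v w : V} :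
    w ∈ G.nbrs U v ↔ w ∈ U ∧ G.Adj v w := by
  simp [nbrs]

/-- The largest value that the vertex `v` can attain if the edges inside `U` are not yet
oriented and `o v` arcs leaving `v` are already fixed. -/
noncomputable def potential (G : SimpleGraph V) (U : Finset V) (o : V → ℕ) (v : V) : ℕ :=
  o v + #(G.nbrs U v)

/-- The subgraph induced on `U` has an orientation in which adjacent vertices have different
values, the value of `v` being its outdegree plus `o v`, and no value exceeds `k v`. -/
def Solvable (G : SimpleGraph V) (U : Finset V) (o k : V → ℕ) : Prop :=
  ∃ out : V → Finset V, (∀ u ∈ U, out u ⊆ G.nbrs U u) ∧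
    (∀ u ∈ U, ∀ v ∈ U, G.Adj u v → (v ∈ out u ↔ u ∉ out v)) ∧
    (∀ u ∈ U, o u + #(out u) ≤ k u) ∧
    ∀ u ∈ U, ∀ v ∈ U, G.Adj u v → o u + #(out u) ≠ o v + #(out v)

theorem Solvable.mono {G : SimpleGraph V} {U : Finset V} {o k k' : V → ℕ}
    (h : G.Solvable U o k) (hk : ∀ u ∈ U, k u ≤ k' u) : G.Solvable U o k' := by
  obtain ⟨out, h1, h2, h3, h4⟩ := h
  exact ⟨out, h1, h2, fun u hu => (h3 u hu).trans (hk u hu), h4⟩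

variable [DecidableEq V]

/-- Ties cannot involve `F`: it is independent, and its neighbours outside it stay below `q`. An
edge at `u ∈ F` not used by `S u` becomes an arc into `u`, which `o'` books at its tail. -/
theorem Solvable.of_pin {G : SimpleGraph V} {U F : Finset V} {o o' k k' : V → ℕ} {q : ℕ}
    {S : V → Finset V} (hF : F ⊆ U) (hind : ∀ u ∈ F, ∀ v ∈ F, ¬ G.Adj u v)
    (hS : ∀ u ∈ F, S u ⊆ G.nbrs U u) (hq : ∀ u ∈ F, o u + #(S u) = q)
    (ho' : ∀ v ∈ U \ F, o' v = o v + #{u ∈ G.nbrs F v | v ∉ S u})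
    (hk : ∀ u ∈ F, q ≤ k u) (hk' : ∀ v ∈ U \ F, k' v ≤ k v)
    (hlt : ∀ u ∈ F, ∀ v ∈ U \ F, G.Adj u v → k' v < q)
    (h : G.Solvable (U \ F) o' k') : G.Solvable U o k := by
  obtain ⟨out, h1, h2, h3, h4⟩ := h
  have hval : ∀ v ∈ U \ F, o v + #(out v ∪ {u ∈ G.nbrs F v | v ∉ S u}) = o' v + #(out v) := by
    intro v hv
    rw [card_union_of_disjoint, ho' v hv]
    · ring
    · rw [Finset.disjoint_left]
      intro w hw hw'
      have := h1 v hv hw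
      simp at this hw'
      tauto
  refine ⟨fun v => if v ∈ F then S v else out v ∪ {u ∈ G.nbrs F v | v ∉ S u}, ?_, ?_, ?_, ?_⟩
  · intro u hu
    by_cases huF : u ∈ F
    · simpa [huF] using hS u huF
    · simp only [huF, if_false]
      intro w hw
      rcases mem_union.1 hw with hw | hw
      · have := h1 u (by simp [hu, huF]) hw
        simp at this ⊢
        tauto
      · simp at hw ⊢
        exact ⟨hF hw.1.1, hw.1.2⟩
  · intro u hu v hv huv
    by_cases huF : u ∈ F <;> by_cases hvF : v ∈ F
    · exact absurd huv (hind u huF v hvF)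
    · have : u ∉ out v := fun h' => by
        have := h1 v (by simp [hv, hvF]) h'
        simp at this; tauto
      simp [huF, hvF, this, huv.symm]
    · have : v ∉ out u := fun h' => by
        have := h1 u (by simp [hu, huF]) h'
        simp at this; tauto
      simp [huF, hvF, this, huv]
    · simpa [huF, hvF] using h2 u (by simp [hu, huF]) v (by simp [hv, hvF]) huv
  · intro u hu
    by_cases huF : u ∈ F
    · simpa [huF, hq u huF] using hk u huF
    · have hu' : u ∈ U \ F := by simp [hu, huF]
      simp only [huF, if_false]
      rw [hval u hu']
      exact (h3 u hu').trans (hk' u hu')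
  · intro u hu v hv huv
    by_cases huF : u ∈ F <;> by_cases hvF : v ∈ F
    · exact absurd huv (hind u huF v hvF)
    · have hv' : v ∈ U \ F := by simp [hv, hvF]
      simp only [huF, hvF, if_false, if_true]
      rw [hval v hv', hq u huF]
      have := hlt u huF v hv' huv
      have := h3 v hv'
      omega
    · have hu' : u ∈ U \ F := by simp [hu, huF]
      simp only [huF, hvF, if_false, if_true]
      rw [hval u hu', hq v hvF]
      have := hlt v hvF u hu' huv.symm
      have := h3 u hu'
      omega
    · have hv' : v ∈ U \ F := by simp [hv, hvF]
      have hu' : u ∈ U \ F := by simp [hu, huF]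
      simp only [huF, hvF, if_false]
      rw [hval u hu', hval v hv']
      exact h4 u hu' v hv' huv

theorem card_nbrs_sdiff {G : SimpleGraph V} {U F : Finset V} (hF : F ⊆ U) (v : V) :
    #(G.nbrs (U \ F) v) + #(G.nbrs F v) = #(G.nbrs U v) := by
  rw [← card_union_of_disjoint]
  · congr 1
    ext w
    have := @hF w
    simp
    tauto
  · rw [Finset.disjoint_left]
    intro w
    simp
    tauto

/-- Making a vertex of largest potential a source, again and again, yields an orientation in which
adjacent vertices have different values. -/
theorem solvable_potential (G : SimpleGraph V) (o : V → ℕ) (U : Finset V) :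
    G.Solvable U o (G.potential U o) := by
  induction U using Finset.strongInduction with
  | H U ih =>
    rcases U.eq_empty_or_nonempty with rfl | hU
    · exact ⟨fun _ => ∅, by simp⟩
    obtain ⟨u, hu, hmax⟩ := exists_max_image U (G.potential U o) hU
    have hF : {u} ⊆ U := by simpa using hu
    refine Solvable.of_pin (F := {u}) (q := G.potential U o u) (S := G.nbrs U)
      (o' := o) (k' := G.potential (U \ {u}) o) hF (by simp) (by simp) (by simp [potential])
      ?_ (by simp) ?_ ?_ (ih _ ?_)
    · intro v hv
      simp only [left_eq_add, card_eq_zero, filter_eq_empty_iff, mem_nbrs, mem_singleton]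
      rintro w ⟨rfl, h⟩
      simp at hv ⊢
      exact ⟨hv.1, h.symm⟩
    · intro v _
      have := card_nbrs_sdiff (G := G) hF v
      simp only [potential]
      omega
    · intro w hw v hv hwv
      obtain rfl := mem_singleton.1 hw
      have h1 := card_nbrs_sdiff (G := G) hF v
      have h2 : 0 < #(G.nbrs {w} v) := card_pos.2 ⟨w, by simpa using hwv.symm⟩
      have h3 := hmax v (mem_sdiff.1 hv).1
      simp only [potential] at h3 ⊢
      omega
    · exact sdiff_ssubset hF (by simp)

/-- At every vertex of `U`, the fixed arcs counted by `o` and the vertices of `U` chosen by `Z` are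
at most two in number. -/
def Sparse (U : Finset V) (Z : V → Finset V) (o : V → ℕ) : Prop :=
  ∀ v ∈ U, o v + #(Z v ∩ U) ≤ 2

/-- One round: the pinned vertices `F` get the value `q`, where `u ∈ F` serves all vertices
of `R u`. -/
theorem exists_pin {G : SimpleGraph V} {U F : Finset V} {o : V → ℕ} {q : ℕ}
    {Z R : V → Finset V} (hZ : ∀ u v, G.Adj u v → v ∈ Z u ∨ u ∈ Z v)
    (hsp : Sparse U Z o) (hF : F ⊆ U) (hind : ∀ u ∈ F, ∀ v ∈ F, ¬ G.Adj u v)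
    (hR : ∀ u ∈ F, R u ⊆ G.nbrs U u) (hq : ∀ u ∈ F, q ≤ G.potential U o u)
    (hload : ∀ u ∈ F, o u + #(R u ∪ (Z u ∩ G.nbrs U u)) ≤ q) (hq0 : 0 < q) :
    ∃ o' : V → ℕ, Sparse (U \ F) Z o' ∧
      (∀ v ∈ U \ F, G.potential (U \ F) o' v + #{u ∈ F | v ∈ R u} ≤ G.potential U o v) ∧
      (G.Solvable (U \ F) o' (fun _ => q - 1) → G.Solvable U o (fun _ => q)) := by
  -- `hload` makes room for the forced out-neighbours, and `hq` provides enough neighbours to fill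
  -- up to exactly `q`.
  have : ∀ u, ∃ S : Finset V, u ∈ F → R u ∪ (Z u ∩ G.nbrs U u) ⊆ S ∧ S ⊆ G.nbrs U u ∧
      #S = q - o u := by
    intro u
    by_cases hu : u ∈ F
    · have h1 := hload u hu
      have h2 := hq u hu
      simp only [potential] at h2
      obtain ⟨S, h⟩ := exists_subsuperset_card_eq (n := q - o u)
        (union_subset (hR u hu) (inter_subset_right (s₁ := Z u))) (by omega) (by omega)
      exact ⟨S, fun _ => h⟩
    · exact ⟨∅, fun h => absurd h hu⟩
  choose S hS using this
  refine ⟨fun v => o v + #{u ∈ G.nbrs F v | v ∉ S u}, ?_, ?_, ?_⟩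
  · intro v hv
    have h1 := hsp v (mem_sdiff.1 hv).1
    -- A new arc from `v` to `u ∈ F` forces `v ∉ Z u`, hence `u ∈ Z v`: it uses up an element of `Z
    -- v`.
    have h2 : #(Z v ∩ (U \ F)) + #{u ∈ G.nbrs F v | v ∉ S u} ≤ #(Z v ∩ U) := by
      rw [← card_union_of_disjoint]
      · apply card_le_card
        intro w hw
        rcases mem_union.1 hw with hw | hw
        · simp at hw ⊢
          tauto
        · simp at hw
          obtain ⟨⟨hwF, hvw⟩, hw⟩ := hw
          have : v ∉ Z w := fun hz => hw ((hS w hwF).1 (by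
            simp at hv; simp [hz, hvw.symm, hv]))
          have := (hZ v w hvw).resolve_right this
          simp [this, hF hwF]
      · rw [Finset.disjoint_left]
        intro w
        simp
        tauto
    simp only
    omega
  · intro v hv
    have h1 := card_nbrs_sdiff (G := G) hF v
    have h2 : #{u ∈ G.nbrs F v | v ∉ S u} + #{u ∈ F | v ∈ R u} ≤ #(G.nbrs F v) := by
      rw [← card_union_of_disjoint]
      · apply card_le_card
        intro w hw
        rcases mem_union.1 hw with hw | hw
        · exact (mem_filter.1 hw).1
        · simp at hw
          have := hR w hw.1 hw.2
          simp at this ⊢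
          exact ⟨hw.1, this.2.symm⟩
      · rw [Finset.disjoint_left]
        intro w hw hw'
        simp at hw hw'
        exact hw.2 ((hS w hw'.1).1 (mem_union_left _ hw'.2))
    simp only [potential]
    omega
  · refine Solvable.of_pin (S := S) (q := q) hF hind (fun u hu => (hS u hu).2.1) ?_
      (fun _ _ => rfl) (by simp) (by simp) (fun _ _ _ _ _ => by omega)
    intro u hu
    have h1 := hload u hu
    have := (hS u hu).2.2
    omega

end Pinning

/-! ### The three kinds of rounds. -/

section Rounds

variable {V : Type*} [DecidableEq V] {G : SimpleGraph V} {Z : V → Finset V}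

/-- Pinning an independent class at the value `q` leaves its other vertices with potential less
than `q`. -/
theorem exists_round_single (hZ : ∀ u v, G.Adj u v → v ∈ Z u ∨ u ∈ Z v) {U : Finset V} {o : V → ℕ}
    (hsp : Sparse U Z o) {X : V → Prop} (hX : ∀ u v, X u → X v → ¬ G.Adj u v) {q : ℕ}
    (hq : 2 ≤ q) :
    ∃ U' ⊆ U, ∃ o' : V → ℕ, Sparse U' Z o' ∧
      (∀ v ∈ U', G.potential U' o' v ≤ G.potential U o v) ∧
      (∀ v ∈ U', X v → G.potential U' o' v ≤ q - 1) ∧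
      (G.Solvable U' o' (fun _ => q - 1) → G.Solvable U o (fun _ => q)) := by
  classical
  let F : Finset V := {v ∈ U | X v ∧ q ≤ G.potential U o v}
  have hF : F ⊆ U := filter_subset _ _
  have hload : ∀ u ∈ F, o u + #(∅ ∪ (Z u ∩ G.nbrs U u)) ≤ q := by
    intro u hu
    have h4 := hsp u (hF hu)
    have h5 : #(Z u ∩ G.nbrs U u) ≤ #(Z u ∩ U) :=
      card_le_card (inter_subset_inter_left fun w hw => (mem_nbrs.1 hw).1)
    simp only [empty_union]
    omega
  obtain ⟨o', h1, h2, h3⟩ := exists_pin (F := F) (R := fun _ => ∅) (q := q) hZ hsp hF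
    (fun u hu v hv => hX u v (mem_filter.1 hu).2.1 (mem_filter.1 hv).2.1) (by simp)
    (fun u hu => (mem_filter.1 hu).2.2) hload (by omega)
  refine ⟨U \ F, sdiff_subset, o', h1, fun v hv => by simpa using h2 v hv, ?_, h3⟩
  intro v hv hXv
  have h4 := (Nat.le_add_right _ _).trans (h2 v hv)
  have h5 : ¬ q ≤ G.potential U o v := fun h => (mem_sdiff.1 hv).2
    (mem_filter.2 ⟨(mem_sdiff.1 hv).1, hXv, h⟩)
  omega

/-- If the potentials in one class are at most `q` and those in another at most `q + 2`, then
vertices of both classes can be pinned at the value `q` so that the remaining vertices of both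
classes have potential less than `q`. -/
theorem exists_round_double (hZ : ∀ u v, G.Adj u v → v ∈ Z u ∨ u ∈ Z v) {U : Finset V} {o : V → ℕ}
    (hsp : Sparse U Z o) {X Y : V → Prop} (hX : ∀ u v, X u → X v → ¬ G.Adj u v)
    (hY : ∀ u v, Y u → Y v → ¬ G.Adj u v) {q : ℕ} (hq : 4 ≤ q)
    (hPX : ∀ v ∈ U, X v → G.potential U o v ≤ q)
    (hPY : ∀ v ∈ U, Y v → G.potential U o v ≤ q + 2) :
    ∃ U' ⊆ U, ∃ o' : V → ℕ, Sparse U' Z o' ∧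
      (∀ v ∈ U', G.potential U' o' v ≤ G.potential U o v) ∧
      (∀ v ∈ U', X v ∨ Y v → G.potential U' o' v ≤ q - 1) ∧
      (G.Solvable U' o' (fun _ => q - 1) → G.Solvable U o (fun _ => q)) := by
  classical
  let XQ : Finset V := {v ∈ U | X v ∧ G.potential U o v = q}
  let YQ : Finset V := {v ∈ U | Y v ∧ q ≤ G.potential U o v}
  -- A valid `S` can serve all critical `X`-vertices adjacent to it, each member serving at most
  -- two; with the two from sparsity this makes the load at most 4. For `S` of maximum size, the
  -- critical `X`-vertices not adjacent to `S` are pinned too, and point to all their neighbours.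
  let valid : Finset V → Prop := fun S => ∃ R : V → Finset V,
    (∀ s ∈ S, R s ⊆ G.nbrs U s ∧ #(R s) ≤ 2) ∧ ∀ x ∈ XQ, (∃ s ∈ S, G.Adj s x) → ∃ s ∈ S, x ∈ R s
  obtain ⟨S, hS, hmax⟩ := exists_max_image (YQ.powerset.filter valid) card
    ⟨∅, mem_filter.2 ⟨by simp, fun _ => ∅, by simp⟩⟩
  obtain ⟨hSY, R, hR, hRX⟩ := mem_filter.1 hS
  rw [mem_powerset] at hSY
  let M : Finset V := {x ∈ XQ | ∀ s ∈ S, ¬ G.Adj s x}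
  have hMX : M ⊆ XQ := filter_subset _ _
  have hSU : S ⊆ U := hSY.trans (filter_subset _ _)
  have hMU : M ⊆ U := hMX.trans (filter_subset _ _)
  have hMS : ∀ x ∈ M, ∀ s ∈ S, ¬ G.Adj s x := fun x hx => (mem_filter.1 hx).2
  have hSv : ∀ s ∈ S, Y s ∧ q ≤ G.potential U o s := fun s hs => (mem_filter.1 (hSY hs)).2
  have hMv : ∀ s ∈ M, X s ∧ G.potential U o s = q := fun s hs => (mem_filter.1 (hMX hs)).2
  have hind : ∀ u ∈ S ∪ M, ∀ v ∈ S ∪ M, ¬ G.Adj u v := by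
    intro u hu v hv huv
    rcases mem_union.1 hu with hu | hu <;> rcases mem_union.1 hv with hv | hv
    · exact hY _ _ (hSv u hu).1 (hSv v hv).1 huv
    · exact hMS v hv u hu huv
    · exact hMS u hu v hv huv.symm
    · exact hX _ _ (hMv u hu).1 (hMv v hv).1 huv
  have hRU : ∀ u ∈ S ∪ M, (if u ∈ S then R u else G.nbrs U u) ⊆ G.nbrs U u := by
    intro u _
    by_cases hu : u ∈ S
    · simpa [hu] using (hR u hu).1
    · simp [hu]
  have hqF : ∀ u ∈ S ∪ M, q ≤ G.potential U o u := by
    intro u hu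
    rcases mem_union.1 hu with hu | hu
    · exact (hSv u hu).2
    · exact (hMv u hu).2.ge
  have hload : ∀ u ∈ S ∪ M,
      o u + #((if u ∈ S then R u else G.nbrs U u) ∪ (Z u ∩ G.nbrs U u)) ≤ q := by
    intro u hu
    by_cases huS : u ∈ S
    · have h4 := hsp u (hSU huS)
      have h5 : #(Z u ∩ G.nbrs U u) ≤ #(Z u ∩ U) :=
        card_le_card (inter_subset_inter_left fun w hw => (mem_nbrs.1 hw).1)
      have h6 := card_union_le (R u) (Z u ∩ G.nbrs U u)
      have h7 := (hR u huS).2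
      simp only [huS, if_true]
      omega
    · have h4 := (hMv u ((mem_union.1 hu).resolve_left huS)).2
      simp only [huS, if_false, union_eq_left.2 (inter_subset_right (s₁ := Z u))]
      exact h4.le
  obtain ⟨o', h1, h2, h3⟩ := exists_pin (F := S ∪ M)
    (R := fun u => if u ∈ S then R u else G.nbrs U u) (q := q) hZ hsp
    (union_subset hSU hMU) hind hRU hqF hload (by omega)
  refine ⟨U \ (S ∪ M), sdiff_subset, o', h1,
    fun v hv => (Nat.le_add_right _ _).trans (h2 v hv), ?_, h3⟩
  intro v hv hXY
  have h4 := h2 v hv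
  have hvU := (mem_sdiff.1 hv).1
  have hvS : v ∉ S := fun h => (mem_sdiff.1 hv).2 (mem_union_left _ h)
  have hvM : v ∉ M := fun h => (mem_sdiff.1 hv).2 (mem_union_right _ h)
  rcases hXY with hXv | hYv
  · have h5 := hPX v hvU hXv
    by_cases h6 : G.potential U o v = q
    · have hvX : v ∈ XQ := mem_filter.2 ⟨hvU, hXv, h6⟩
      have : ∃ s ∈ S, G.Adj s v := by
        by_contra! h
        exact hvM (mem_filter.2 ⟨hvX, h⟩)
      obtain ⟨s, hs, hsv⟩ := hRX v hvX this
      have : 0 < #{u ∈ S ∪ M | v ∈ if u ∈ S then R u else G.nbrs U u} :=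
        card_pos.2 ⟨s, by simp [hs, hsv]⟩
      omega
    · omega
  · by_cases h6 : q ≤ G.potential U o v
    · have hsub : G.nbrs M v ⊆ {u ∈ S ∪ M | v ∈ if u ∈ S then R u else G.nbrs U u} := by
        intro u hu
        rw [mem_nbrs] at hu
        have : u ∉ S := fun h => hY _ _ hYv (hSv u h).1 hu.2
        simp [hu.1, this, hvU, hu.2.symm]
      have h7 := card_le_card hsub
      by_cases h8 : G.potential U o v - q < #(G.nbrs M v)
      · omega
      -- Here `v` has at most `potential - q ≤ 2` neighbours in `M`, so it could join `S` and serve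
      -- them all, against maximality.
      · exfalso
        have h9 := hPY v hvU hYv
        have := hmax (insert v S) (mem_filter.2 ⟨?_, Function.update R v (G.nbrs M v), ?_, ?_⟩)
        · rw [card_insert_of_notMem hvS] at this
          omega
        · rw [mem_powerset]
          exact insert_subset (mem_filter.2 ⟨hvU, hYv, h6⟩) hSY
        · intro s hs
          by_cases hsv : s = v
          · subst hsv
            simp only [Function.update_self]
            refine ⟨fun w hw => ?_, by omega⟩
            rw [mem_nbrs] at hw ⊢
            exact ⟨hMU hw.1, hw.2⟩
          · simpa [hsv] using hR s ((mem_insert.1 hs).resolve_left hsv)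
        · rintro x hx ⟨s, hs, hsx⟩
          by_cases hxM : x ∈ M
          · have hsv : s = v := (mem_insert.1 hs).resolve_right fun h => hMS x hxM s h hsx
            subst hsv
            exact ⟨s, mem_insert_self _ _, by simp [hxM, hsx]⟩
          · have : ∃ s ∈ S, G.Adj s x := by
              by_contra! h
              exact hxM (mem_filter.2 ⟨hx, h⟩)
            obtain ⟨t, ht, htx⟩ := hRX x hx this
            refine ⟨t, mem_insert_of_mem ht, ?_⟩
            rw [Function.update_of_ne (by rintro rfl; exact hvS ht)]
            exact htx
    · omega

/-- If each of the sets `t i` has at least two elements and every element lies in at most two of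
them, then they have a system of distinct representatives. -/
theorem exists_injective_of_two_le {ι α : Type*} [DecidableEq α] (t : ι → Finset α)
    (h2 : ∀ i, 2 ≤ #(t i)) (hle : ∀ a, ∃ s : Finset ι, #s ≤ 2 ∧ ∀ k, a ∈ t k → k ∈ s) :
    ∃ f : ι → α, Function.Injective f ∧ ∀ i, f i ∈ t i := by
  classical
  refine (Finset.all_card_le_biUnion_card_iff_exists_injective t).1 fun s => ?_
  -- Hall's condition, by double counting incidences.
  have := card_mul_le_card_mul (s := s) (t := s.biUnion t) (fun i a => a ∈ t i) (m := 2) (n := 2)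
    ?_ ?_
  · omega
  · intro i hi
    refine (h2 i).trans (card_le_card fun a ha => ?_)
    rw [mem_bipartiteAbove (fun i a => a ∈ t i)]
    exact ⟨mem_biUnion.2 ⟨i, hi, ha⟩, ha⟩
  · intro a _
    obtain ⟨r, hr, hra⟩ := hle a
    exact (card_le_card fun k hk =>
      hra k ((mem_bipartiteBelow (fun i a => a ∈ t i)).1 hk).2).trans hr

/-- If all potentials are at most `q`, up to an excess of one in a single colour class, then
vertices can be pinned at the value `q` so that all remaining potentials are less than `q`. The
pinned set maximises a weight: vertices of potential `q` weigh `2`, those of potential `q + 1`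
weigh `3`. -/
theorem exists_round_triple (hZ : ∀ u v, G.Adj u v → v ∈ Z u ∨ u ∈ Z v) {U : Finset V} {o : V → ℕ}
    (hsp : Sparse U Z o) {c : V → Fin 3} (hc : ∀ u v, G.Adj u v → c u ≠ c v) {a : Fin 3} {q : ℕ}
    (hq : 5 ≤ q) (hP : ∀ v ∈ U, c v ≠ a → G.potential U o v ≤ q)
    (hPa : ∀ v ∈ U, c v = a → G.potential U o v ≤ q + 1) :
    ∃ U' ⊆ U, ∃ o' : V → ℕ, Sparse U' Z o' ∧
      (∀ v ∈ U', G.potential U' o' v ≤ q - 1) ∧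
      (G.Solvable U' o' (fun _ => q - 1) → G.Solvable U o (fun _ => q)) := by
  classical
  let T : Finset V := {v ∈ U | q ≤ G.potential U o v}
  let wt : V → ℕ := fun v => G.potential U o v + 2 - q
  let indep : Finset V → Prop := fun F => ∀ u ∈ F, ∀ v ∈ F, ¬ G.Adj u v
  obtain ⟨F, hF, hmax⟩ := exists_max_image (T.powerset.filter indep) (fun F => ∑ v ∈ F, wt v)
    ⟨∅, mem_filter.2 ⟨by simp, by simp [indep]⟩⟩
  obtain ⟨hFT, hind⟩ := mem_filter.1 hF
  rw [mem_powerset] at hFT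
  have hFU : F ⊆ U := hFT.trans (filter_subset _ _)
  have hFq : ∀ v ∈ F, q ≤ G.potential U o v := fun v hv => (mem_filter.1 (hFT hv)).2
  have hle : ∀ v ∈ U, G.potential U o v ≤ q + 1 := fun v hv => by
    by_cases h : c v = a
    · exact hPa v hv h
    · exact (hP v hv h).trans (Nat.le_succ q)
  have hca : ∀ v ∈ U, G.potential U o v = q + 1 → c v = a := fun v hv h => by
    by_contra h'
    have := hP v hv h'
    omega
  have hexch : ∀ A ⊆ T \ F, indep A →
      ∑ v ∈ A, wt v ≤ ∑ v ∈ F with ∃ x ∈ A, G.Adj x v, wt v := by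
    intro A hA hAi
    have h1 := hmax ({v ∈ F | ¬ ∃ x ∈ A, G.Adj x v} ∪ A) (mem_filter.2 ⟨?_, ?_⟩)
    · rw [sum_union] at h1
      · have := sum_filter_add_sum_filter_not F (fun v => ∃ x ∈ A, G.Adj x v) wt
        omega
      · rw [Finset.disjoint_left]
        intro w hw hw'
        exact (mem_sdiff.1 (hA hw')).2 (mem_filter.1 hw).1
    · rw [mem_powerset]
      exact union_subset ((filter_subset _ _).trans hFT) (hA.trans sdiff_subset)
    · intro u hu v hv huv
      rcases mem_union.1 hu with hu | hu <;> rcases mem_union.1 hv with hv | hv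
      · exact hind u (mem_filter.1 hu).1 v (mem_filter.1 hv).1 huv
      · exact (mem_filter.1 hu).2 ⟨v, hv, huv.symm⟩
      · exact (mem_filter.1 hv).2 ⟨u, hu, huv⟩
      · exact hAi u hu v hv huv
  have hexch1 : ∀ x ∈ U, x ∉ F → q ≤ G.potential U o x → wt x ≤ ∑ v ∈ G.nbrs F x, wt v := by
    intro x hx hxF hxq
    have := hexch {x} (by simp [T, hx, hxF, hxq]) (by simp [indep])
    simp only [sum_singleton, mem_singleton, exists_eq_left] at this
    convert this using 2
    ext; simp
  let S : Finset V := {s ∈ F | G.potential U o s = q + 1}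
  have hSF : S ⊆ F := filter_subset _ _
  have hSq : ∀ s ∈ S, G.potential U o s = q + 1 := fun s hs => (mem_filter.1 hs).2
  -- Critical vertices whose only neighbour in `F` is `s`. Two non-adjacent ones (weight 4) could
  -- replace `s` (weight 3), so they form a clique; avoiding the colour of `s`, it has at most two
  -- elements.
  let Pr : V → Finset V := fun s =>
    {x ∈ G.nbrs U s | x ∉ F ∧ G.potential U o x = q ∧ G.nbrs F x = {s}}
  have hPr : ∀ s ∈ S, #(Pr s) ≤ 2 := by
    intro s hs
    have hcl : ∀ x ∈ Pr s, ∀ y ∈ Pr s, x ≠ y → G.Adj x y := by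
      intro x hx y hy hxy
      by_contra hadj
      simp only [Pr, mem_filter, mem_nbrs] at hx hy
      have h1 := hexch {x, y} ?_ ?_
      · rw [sum_pair hxy] at h1
        have h2 : ∑ v ∈ F with ∃ z ∈ ({x, y} : Finset V), G.Adj z v, wt v ≤ ∑ v ∈ {s}, wt v := by
          apply sum_le_sum_of_subset
          intro v hv
          simp only [mem_filter, mem_insert, mem_singleton, exists_eq_or_imp, exists_eq_left] at hv
          rcases hv.2 with h | h
          · rw [← hx.2.2.2]; simp [hv.1, h]
          · rw [← hy.2.2.2]; simp [hv.1, h]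
        rw [sum_singleton] at h2
        have := hSq s hs
        simp only [wt] at h1 h2
        omega
      · intro z hz
        simp only [mem_insert, mem_singleton] at hz
        rcases hz with rfl | rfl
        · simp [T, hx.1.1, hx.2.1, hx.2.2.1]
        · simp [T, hy.1.1, hy.2.1, hy.2.2.1]
      · intro u hu v hv
        simp only [mem_insert, mem_singleton] at hu hv
        rcases hu with rfl | rfl <;> rcases hv with rfl | rfl
        · simp
        · exact hadj
        · exact fun h => hadj h.symm
        · simp
    have h1 : #(Pr s) ≤ #((univ : Finset (Fin 3)).erase (c s)) := by
      apply card_le_card_of_injOn c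
      · intro x hx
        simp only [Pr, coe_filter, Set.mem_ofPred_eq, mem_nbrs] at hx
        simpa using hc x s hx.1.2.symm
      · intro x hx y hy hxy
        by_contra hne
        exact hc x y (hcl x hx y hy hne) hxy
    simpa using h1
  -- Each `s ∈ S` has potential `q + 1` and must leave out one neighbour `μ s`. The candidates
  -- number at least `(q + 1) - 2 - 2 ≥ 2`.
  let Y : V → Finset V := fun s => (G.nbrs U s \ Z s) \ Pr s
  have hY : ∀ s ∈ S, 2 ≤ #(Y s) := by
    intro s hs
    have h1 := le_card_sdiff (Z s ∩ U) (G.nbrs U s)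
    have h2 := le_card_sdiff (Pr s) (G.nbrs U s \ Z s)
    have h3 := hPr s hs
    have h4 := hsp s (hFU (hSF hs))
    have h5 := hSq s hs
    have h6 : G.nbrs U s \ (Z s ∩ U) = G.nbrs U s \ Z s := by
      ext w; simp; tauto
    rw [h6] at h1
    simp only [potential] at h5
    simp only [Y]
    omega
  let D : Finset V := {x ∈ U \ F | 2 ≤ #(G.nbrs S x) ∧ ∀ s ∈ G.nbrs S x, x ∈ Y s}
  -- Pairs are edges: `s ∈ S` claims the edge it leaves out, `x ∈ D` an edge to `S` that must be
  -- kept. Distinct representatives ensure that no `x ∈ D` is left out by all its neighbours in `S`.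
  -- An edge can be claimed only by its two ends.
  let t : {v // v ∈ S ∪ D} → Finset (V × V) := fun v =>
    if v.1 ∈ S then {v.1} ×ˢ Y v.1 else G.nbrs S v.1 ×ˢ {v.1}
  obtain ⟨f, hf, hft⟩ := exists_injective_of_two_le t (by
    rintro ⟨v, hv⟩
    by_cases h : v ∈ S
    · simpa [t, h] using hY v h
    · simpa [t, h] using (mem_filter.1 ((mem_union.1 hv).resolve_left h)).2.1) (by
    rintro ⟨x, y⟩
    have hsub : ∀ k : {v // v ∈ S ∪ D}, (x, y) ∈ t k → k.1 = x ∨ k.1 = y := by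
      rintro ⟨k, hk⟩ hxy
      by_cases h : k ∈ S
      · simp only [t, h, if_true, mem_product, mem_singleton] at hxy
        exact Or.inl hxy.1.symm
      · simp only [t, h, if_false, mem_product, mem_singleton] at hxy
        exact Or.inr hxy.2.symm
    refine ⟨({x, y} : Finset V).subtype (· ∈ S ∪ D), ?_, fun k hk => ?_⟩
    · rw [card_subtype]
      exact (card_filter_le _ _).trans card_le_two
    · simpa using hsub k hk)
  let μ : V → V := fun s => if h : s ∈ S ∪ D then (f ⟨s, h⟩).2 else s
  have hμ : ∀ s ∈ S, μ s ∈ Y s := by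
    intro s hs
    have h := mem_union_left D hs
    have := hft ⟨s, h⟩
    simp only [t, hs, if_true, mem_product] at this
    simpa only [μ, h, dif_pos] using this.2
  let R : V → Finset V := fun u =>
    if G.potential U o u = q then G.nbrs U u else (G.nbrs U u).erase (μ u)
  have hRU : ∀ u ∈ F, R u ⊆ G.nbrs U u := by
    intro u _
    by_cases h : G.potential U o u = q
    · simp [R, h]
    · simpa [R, h] using erase_subset _ _
  have hload : ∀ u ∈ F, o u + #(R u ∪ (Z u ∩ G.nbrs U u)) ≤ q := by
    intro u hu
    by_cases h : G.potential U o u = q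
    · simp only [R, h, if_true, union_eq_left.2 (inter_subset_right (s₁ := Z u))]
      exact h.le
    · have h4 : G.potential U o u = q + 1 := by
        have := hle u (hFU hu)
        have := hFq u hu
        omega
      have h5 := hμ u (mem_filter.2 ⟨hu, h4⟩)
      simp only [Y, mem_sdiff] at h5
      have h6 : (G.nbrs U u).erase (μ u) ∪ Z u ∩ G.nbrs U u = (G.nbrs U u).erase (μ u) := by
        rw [union_eq_left]
        intro w hw
        rw [mem_inter] at hw
        refine mem_erase.2 ⟨?_, hw.2⟩
        rintro rfl
        exact h5.1.2 hw.1
      simp only [R, h, if_false, h6, card_erase_of_mem h5.1.1]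
      have h7 := card_pos.2 ⟨_, h5.1.1⟩
      simp only [potential] at h4
      omega
  obtain ⟨o', h1, h2, h3⟩ := exists_pin (F := F) (R := R) (q := q) hZ hsp hFU hind hRU hFq hload
    (by omega)
  refine ⟨U \ F, sdiff_subset, o', h1, ?_, h3⟩
  intro v hv
  obtain ⟨hvU, hvF⟩ := mem_sdiff.1 hv
  have h4 := h2 v hv
  by_cases h5 : q ≤ G.potential U o v
  · have h6 := hexch1 v hvU hvF h5
    rcases (show G.potential U o v = q ∨ G.potential U o v = q + 1 by
      have := hle v hvU; omega) with h7 | h7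
    · suffices h : ∃ u ∈ F, v ∈ R u by
        obtain ⟨u, hu, hvu⟩ := h
        have : 0 < #{u ∈ F | v ∈ R u} := card_pos.2 ⟨u, by simp [hu, hvu]⟩
        omega
      by_contra! hno
      have hS : G.nbrs F v = G.nbrs S v := by
        ext u
        simp only [mem_nbrs]
        refine ⟨fun h => ⟨mem_filter.2 ⟨h.1, ?_⟩, h.2⟩, fun h => ⟨hSF h.1, h.2⟩⟩
        have h8 := hno u h.1
        have h9 := hle u (hFU h.1)
        have h10 := hFq u h.1
        by_contra h11
        have h12 : G.potential U o u = q := by omega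
        exact h8 (by simp [R, h12, hvU, h.2.symm])
      have hvμ : ∀ s ∈ G.nbrs S v, v = μ s := by
        intro s hs
        rw [mem_nbrs] at hs
        by_contra h8
        have h9 := hSq s hs.1
        exact hno s (hSF hs.1) (by simp [R, h9, h8, hvU, hs.2.symm])
      have hvY : ∀ s ∈ G.nbrs S v, v ∈ Y s := by
        intro s hs
        rw [hvμ s hs]
        exact hμ s (mem_nbrs.1 hs).1
      have hcard : 2 ≤ #(G.nbrs S v) := by
        by_contra hlt
        rcases (show #(G.nbrs S v) = 0 ∨ #(G.nbrs S v) = 1 by omega) with h0 | h0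
        · rw [hS, card_eq_zero.1 h0, sum_empty] at h6
          simp only [wt] at h6
          omega
        · obtain ⟨s, hs⟩ := card_eq_one.1 h0
          have hsv : s ∈ G.nbrs S v := by simp [hs]
          have h8 := hvY s hsv
          refine (mem_sdiff.1 h8).2 (mem_filter.2 ⟨?_, hvF, h7, by rw [hS, hs]⟩)
          simp [hvU, (mem_nbrs.1 hsv).2.symm]
      have hvD : v ∈ D := mem_filter.2 ⟨hv, hcard, hvY⟩
      have hvS : v ∉ S := fun h => hvF (hSF h)
      have h8 := hft ⟨v, mem_union_right _ hvD⟩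
      simp only [t, hvS, if_false, mem_product, mem_singleton] at h8
      set s := (f ⟨v, mem_union_right _ hvD⟩).1 with hs
      have hsS := (mem_nbrs.1 h8.1).1
      have h9 := hvμ s h8.1
      have h10 := hft ⟨s, mem_union_left _ hsS⟩
      simp only [t, hsS, if_true, mem_product, mem_singleton] at h10
      simp only [μ, mem_union_left D hsS, dif_pos] at h9
      have h11 : f ⟨s, mem_union_left _ hsS⟩ = f ⟨v, mem_union_right _ hvD⟩ :=
        Prod.ext (h10.1.trans hs) (h9.symm.trans h8.2.symm)
      have := congrArg Subtype.val (hf h11)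
      simp only at this
      exact hvS (this ▸ hsS)
    -- This potential must drop by two. Vertices of potential `q + 1` share a colour, so the
    -- neighbours of `v` in `F` weigh 2 each and point everywhere; the exchange bound 3 forces at
    -- least two of them.
    · have hnb : ∀ u ∈ G.nbrs F v, G.potential U o u = q := by
        intro u hu
        rw [mem_nbrs] at hu
        have h8 := hle u (hFU hu.1)
        have h9 := hFq u hu.1
        by_contra h10
        exact hc v u hu.2 ((hca v hvU h7).trans (hca u (hFU hu.1) (by omega)).symm)
      have h8 : ∑ u ∈ G.nbrs F v, wt u = #(G.nbrs F v) * 2 := by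
        rw [sum_const_nat]
        intro u hu
        simp only [wt, hnb u hu]
        omega
      have h9 : G.nbrs F v ⊆ {u ∈ F | v ∈ R u} := by
        intro u hu
        have := mem_nbrs.1 hu
        simp [R, hnb u hu, this.1, hvU, this.2.symm]
      have h10 := card_le_card h9
      simp only [wt] at h6 h8
      omega
  · omega

end Rounds

/-! ### Degeneracy and the sequence of rounds. -/

theorem exists_coloring_of_degenerate {V : Type*} [DecidableEq V] {G : SimpleGraph V}
    (hG : ∀ X : Finset V, X.Nonempty → ∃ v ∈ X, #(G.nbrs X v) ≤ 2) (X : Finset V) :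
    ∃ (c : V → Fin 3) (Z : V → Finset V), (∀ v, #(Z v) ≤ 2) ∧
      ∀ u ∈ X, ∀ v ∈ X, G.Adj u v → c u ≠ c v ∧ (v ∈ Z u ∨ u ∈ Z v) := by
  induction X using Finset.strongInduction with
  | H X ih =>
    rcases X.eq_empty_or_nonempty with rfl | hX
    · exact ⟨fun _ => 0, fun _ => ∅, by simp⟩
    obtain ⟨v, hv, hdeg⟩ := hG X hX
    obtain ⟨c, Z, hZ, hcZ⟩ := ih (X.erase v) (erase_ssubset hv)
    obtain ⟨a, ha⟩ : ∃ a : Fin 3, a ∉ (G.nbrs X v).image c := by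
      by_contra! h
      have h1 := card_le_card (s := univ) (t := (G.nbrs X v).image c) fun a _ => h a
      have h2 := card_image_le (s := G.nbrs X v) (f := c)
      simp only [card_univ, Fintype.card_fin] at h1
      omega
    have ha' : ∀ w ∈ X, G.Adj v w → c w ≠ a := fun w hw hvw h =>
      ha (mem_image.2 ⟨w, mem_nbrs.2 ⟨hw, hvw⟩, h⟩)
    refine ⟨Function.update c v a, Function.update Z v (G.nbrs X v), ?_, ?_⟩
    · intro w
      by_cases h : w = v
      · subst h; simpa using hdeg
      · simpa [h] using hZ w
    · intro u hu w hw huw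
      by_cases h1 : u = v
      · subst h1
        have h2 : w ≠ u := huw.ne'
        simp [h2, (ha' w hw huw).symm, hw, huw]
      · by_cases h2 : w = v
        · subst h2
          simp [h1, ha' u hu huw.symm, hu, huw.symm]
        · simpa [h1, h2] using hcZ u (by simp [h1, hu]) w (by simp [h2, hw]) huw

/-- Bounds on the potentials in classes 0, 1, 2: the single rounds give 7, 8, 9. The round at 7
takes classes 0 and 2 to 6, the round at 6 takes classes 2 and 1 to 5. Class 0 then exceeds 5 by at
most one, as the last round allows. -/
theorem solvable_ten {V : Type*} [DecidableEq V] {G : SimpleGraph V} {c : V → Fin 3}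
    {Z : V → Finset V} (hZ2 : ∀ v, #(Z v) ≤ 2) (hc : ∀ u v, G.Adj u v → c u ≠ c v)
    (hZ : ∀ u v, G.Adj u v → v ∈ Z u ∨ u ∈ Z v) (U : Finset V) :
    G.Solvable U (fun _ => 0) (fun _ => 10) := by
  have hX : ∀ a u v, c u = a → c v = a → ¬ G.Adj u v := fun a u v hu hv h =>
    hc u v h (hu.trans hv.symm)
  have hs0 : Sparse U Z (fun _ => 0) := fun v _ => by
    simpa using (card_le_card inter_subset_left).trans (hZ2 v)
  obtain ⟨U₁, hU₁, o₁, hs₁, hm₁, hp₁, hr₁⟩ :=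
    exists_round_single hZ hs0 (hX 2) (q := 10) (by norm_num)
  obtain ⟨U₂, hU₂, o₂, hs₂, hm₂, hp₂, hr₂⟩ :=
    exists_round_single hZ hs₁ (hX 1) (q := 9) (by norm_num)
  obtain ⟨U₃, hU₃, o₃, hs₃, hm₃, hp₃, hr₃⟩ :=
    exists_round_single hZ hs₂ (hX 0) (q := 8) (by norm_num)
  obtain ⟨U₄, hU₄, o₄, hs₄, hm₄, hp₄, hr₄⟩ :=
    exists_round_double hZ hs₃ (hX 0) (hX 2) (q := 7) (by norm_num) (fun v hv h => hp₃ v hv h)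
      (fun v hv h => (hm₃ v hv).trans ((hm₂ v (hU₃ hv)).trans (hp₁ v (hU₂ (hU₃ hv)) h)))
  obtain ⟨U₅, hU₅, o₅, hs₅, hm₅, hp₅, hr₅⟩ :=
    exists_round_double hZ hs₄ (hX 2) (hX 1) (q := 6) (by norm_num)
      (fun v hv h => hp₄ v hv (Or.inr h))
      (fun v hv h => (hm₄ v hv).trans ((hm₃ v (hU₄ hv)).trans (hp₂ v (hU₃ (hU₄ hv)) h)))
  obtain ⟨U₆, hU₆, o₆, hs₆, hp₆, hr₆⟩ :=
    exists_round_triple hZ hs₅ hc (a := 0) (q := 5) le_rfl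
      (fun v hv h => hp₅ v hv (by revert h; generalize c v = a; revert a; decide))
      (fun v hv h => (hm₅ v hv).trans (hp₄ v (hU₅ hv) (Or.inl h)))
  exact hr₁ (hr₂ (hr₃ (hr₄ (hr₅ (hr₆ ((solvable_potential G o₆ U₆).mono hp₆))))))

theorem properChromaticNumber_le_of_solvable {V : Type*} [Fintype V] {G : SimpleGraph V} {k : ℕ}
    (h : G.Solvable univ (fun _ => 0) (fun _ => k)) : G.properChromaticNumber ≤ k := by
  obtain ⟨out, h1, h2, h3, h4⟩ := h
  have hd : ∀ v, outdegree ⟨fun u w => w ∈ out u⟩ v = #(out v) := fun v => by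
    simp [outdegree]
  refine iInf₂_le_of_le ⟨fun u w => w ∈ out u⟩ ⟨⟨?_, ?_⟩, ?_⟩ (iSup_le fun v => ?_)
  · intro u v huv
    exact (mem_nbrs.1 (h1 u (mem_univ u) huv)).2
  · intro u v huv
    have := h2 u (mem_univ u) v (mem_univ v) huv
    simp only [Xor]
    tauto
  · intro u v huv
    rw [hd, hd]
    simpa using h4 u (mem_univ u) v (mem_univ v) huv
  · rw [hd]
    simpa using h3 v (mem_univ v)

/-! ### Tree-width at most 2 implies 2-degeneracy. -/

namespace TreeDecomposition

variable {V ι : Type*} {G : SimpleGraph V}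

/-- The path between two nodes whose bags contain `v` stays within such nodes. -/
theorem mem_bag_of_mem_support (T : G.TreeDecomposition ι) {v : V} {s t : ι} (hs : v ∈ T.bag s)
    (ht : v ∈ T.bag t) {p : T.tree.Walk s t} (hp : p.IsPath) {x : ι} (hx : x ∈ p.support) :
    v ∈ T.bag x := by
  classical
  obtain ⟨w⟩ := T.connected v ⟨s, hs⟩ ⟨t, ht⟩
  let w' := w.map (Embedding.induce {t | v ∈ T.bag t}).toHom
  have h : p = w'.bypass := (T.isTree.existsUnique_path s t).unique hp w'.bypass_isPath
  have h1 := w'.support_bypass_subset_support (h ▸ hx)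
  rw [Walk.support_map, List.mem_map] at h1
  obtain ⟨y, _, rfl⟩ := h1
  exact y.2

/-- If `m` is a node nearest to `r` among those whose bags contain `v`, then the path to `r` from
any other such node passes through `m`. -/
theorem nearest_mem_support (T : G.TreeDecomposition ι) {v : V} {r m t : ι} (hm : v ∈ T.bag m)
    (hmin : ∀ s, v ∈ T.bag s → T.tree.dist m r ≤ T.tree.dist s r) (ht : v ∈ T.bag t)
    {p : T.tree.Walk t r} (hp : p.IsPath) : m ∈ p.support := by
  classical
  obtain ⟨a, ha⟩ := (T.isTree.existsUnique_path t m).exists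
  obtain ⟨b, hb⟩ := T.isTree.connected.exists_walk_length_eq_dist m r
  have hbp := b.isPath_of_length_eq_dist hb
  have hab : (a.append b).IsPath := by
    rw [Walk.isPath_def, Walk.support_append, List.nodup_append]
    refine ⟨ha.support_nodup, hbp.support_nodup.tail, fun x hx y hy hxy => ?_⟩
    subst hxy
    have h1 := hmin x (T.mem_bag_of_mem_support ht hm ha hx)
    have hxb := List.mem_of_mem_tail hy
    have hmx : m ≠ x := by
      rintro rfl
      have := hbp.support_nodup
      rw [← Walk.cons_tail_support, List.nodup_cons] at this
      exact this.1 hy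
    have h2 := Walk.length_dropUntil_lt_length hxb hmx.symm
    have h3 := dist_le (b.dropUntil x hxb)
    omega
  have h : p = a.append b := (T.isTree.existsUnique_path t r).unique hp hab
  rw [h, Walk.mem_support_append_iff]
  exact Or.inl a.end_mem_support

/-- In every nonempty finite set `X` of vertices, some vertex shares a bag with all of its
neighbours in `X`. -/
theorem exists_nbrs_subset_bag [DecidableEq V] (T : G.TreeDecomposition ι) {X : Finset V}
    (hX : X.Nonempty) : ∃ v ∈ X, ∃ m, v ∈ T.bag m ∧ ∀ w ∈ G.nbrs X v, w ∈ T.bag m := by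
  classical
  obtain ⟨r⟩ := T.isTree.connected.nonempty
  have : ∀ v, ∃ m, v ∈ T.bag m ∧ ∀ s, v ∈ T.bag s → T.tree.dist m r ≤ T.tree.dist s r := by
    intro v
    obtain ⟨m, hm, hmin⟩ := WellFounded.has_min
      (InvImage.wf (fun s => T.tree.dist s r) Nat.lt_wfRel.wf) {t | v ∈ T.bag t} (T.vertex_mem v)
    exact ⟨m, hm, fun s hs => not_lt.1 (hmin s hs)⟩
  choose top htop hmin using this
  -- Root the tree at `r`; the vertex whose topmost node is deepest works, with that node.
  obtain ⟨v, hv, hmax⟩ := exists_max_image X (fun v => T.tree.dist (top v) r) hX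
  refine ⟨v, hv, top v, htop v, fun w hw => ?_⟩
  rw [mem_nbrs] at hw
  obtain ⟨t, hvt, hwt⟩ := T.edge_mem v w hw.2
  obtain ⟨p, hp⟩ := T.isTree.connected.exists_walk_length_eq_dist t r
  have hpp := p.isPath_of_length_eq_dist hp
  have h1 := T.nearest_mem_support (htop v) (hmin v) hvt hpp
  have h2 := T.nearest_mem_support (htop w) (hmin w) hwt hpp
  by_cases h3 : top v ∈ (p.takeUntil _ h2).support
  · exact T.mem_bag_of_mem_support hwt (htop w) (hpp.takeUntil h2) h3
  · exfalso
    have h4 : top v ∈ (p.dropUntil _ h2).support := by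
      have := h1
      rw [← p.take_spec h2, Walk.mem_support_append_iff] at this
      exact this.resolve_left h3
    have h5 : top v ≠ top w := fun h => h3 (by rw [h]; exact Walk.end_mem_support _)
    have h6 := Walk.length_dropUntil_lt_length h4 h5
    have h7 := dist_le ((p.dropUntil _ h2).dropUntil _ h4)
    have h8 := hmax w hw.1
    have h9 := congrArg Walk.length (p.take_spec h2)
    rw [Walk.length_append] at h9
    have h10 := T.isTree.connected.dist_triangle (u := t) (v := top w) (w := r)
    have h11 := dist_le (p.takeUntil _ h2)
    omega

end TreeDecomposition

theorem exists_card_nbrs_le_two {V : Type*} [DecidableEq V] {G : SimpleGraph V}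
    (hG : G.treewidth ≤ 2) (X : Finset V) (hX : X.Nonempty) : ∃ v ∈ X, #(G.nbrs X v) ≤ 2 := by
  obtain ⟨n, T, hT⟩ : ∃ n, ∃ T : G.TreeDecomposition (Fin n), T.width ≤ 2 := by
    by_contra! h
    have : (3 : ℕ∞) ≤ G.treewidth := le_iInf₂ fun n T => by
      have := Order.add_one_le_of_lt (h n T)
      exact this
    exact absurd (this.trans hG) (by decide)
  obtain ⟨v, hv, m, hvm, hm⟩ := T.exists_nbrs_subset_bag hX
  refine ⟨v, hv, ?_⟩
  have h1 : (T.bag m).encard ≤ 3 := by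
    have h2 : (⨆ t, (T.bag t).encard) ≤ 2 + 1 := tsub_le_iff_right.1 hT
    exact (le_iSup (fun t => (T.bag t).encard) m).trans h2
  have h2 : ((insert v (G.nbrs X v) : Finset V) : Set V) ⊆ T.bag m := by
    intro w hw
    rcases mem_insert.1 hw with rfl | hw
    · exact hvm
    · exact hm w hw
  have h3 := (Set.encard_le_encard h2).trans h1
  rw [Set.encard_coe_eq_coe_finsetCard, card_insert_of_notMem (by simp)] at h3
  have : #(G.nbrs X v) + 1 ≤ 3 := by exact_mod_cast h3
  omega

end SimpleGraph

theorem mainTheorem7 {V : Type*} [Finite V] (G : SimpleGraph V) (hG : G.treewidth ≤ 2) :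
    G.properChromaticNumber ≤ 10 := by
  classical
  have := Fintype.ofFinite V
  obtain ⟨c, Z, hZ2, h⟩ := SimpleGraph.exists_coloring_of_degenerate
    (SimpleGraph.exists_card_nbrs_le_two hG) Finset.univ
  have h' := fun u v => h u (Finset.mem_univ u) v (Finset.mem_univ v)
  exact SimpleGraph.properChromaticNumber_le_of_solvable (k := 10) (SimpleGraph.solvable_ten hZ2
    (fun u v huv => (h' u v huv).1) (fun u v huv => (h' u v huv).2) Finset.univ)
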